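/- Let $\mathcal E$ be the set of all measurable functions $f\colon[0,1]\to[0,\infty)$ that are (weakly) decreasing and satisfy $f(0)=1$ and $\int_0^1 f>0$. For $f\in\mathcal E$ define the pseudo-inverse $f^*(y):=\sup\{x\in[0,1] : f(x)\ge y\}$ for $y\in[0,1]$, and put $$(Tf)(x):=\frac{\int_x^1 f^*}{\int_0^1 f^*}\qquad(x\in[0,1])$$ (here $\int_0^1 f^*=\int_0^1 f$). Let $T^r$ denote the $r$-th iterate of $T$, let $h_n:=T^n 1_{[0,1]}$ for $n\ge 0$, where $1_{[0,1]}$ is the constant function $1$ on $[0,1]$, and let $h:=\lim_{n\to\infty}h_n$. Theorem. The sequence $(h_n)$ converges uniformly on $[0,1]$, so that $h$ is well defined; moreover $h\in\mathcal E$, $Th=h$, and $h$ is a unit stribola, that is, $h$ is a differentiable bijection $[0,1]\to[0,1]$ with $-\gamma h'=h^{-1}$ on $[0,1]$ for some $\gamma>0$ (where $h^{-1}$ is the compositional inverse). If an integer $r\ge 1$ and a function $g\in\mathcal E$ satisfy $T^r g=g$, then $g=h$. Thus $h$ is the only periodic point of $T$ in $\mathcal E$. -/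

import Mathlib

open Set Filter Topology

namespace Stribola

noncomputable section

/-- The integral `∫_a^b f` for `a, b ∈ [0,1]` of a real function `f` on `[0,1]`
(`Set.IccExtend` only turns `f` into a function on `ℝ`; it is `f` on `[0,1]`). -/
def integral (f : unitInterval → ℝ) (a b : unitInterval) : ℝ :=
  ∫ t in (a : ℝ)..(b : ℝ), IccExtend (zero_le_one : (0 : ℝ) ≤ 1) f t

/-- The area `∫_0^1 f`. -/
def area (f : unitInterval → ℝ) : ℝ := integral f 0 1

/-- The space `𝓔` of all measurable `f : [0,1] → [0,∞)` that are (weakly) decreasing, with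
`f(0) = 1` and positive area. -/
def E : Set (unitInterval → ℝ) :=
  {f | Measurable f ∧ (∀ x, 0 ≤ f x) ∧ Antitone f ∧ f 0 = 1 ∧ 0 < area f}

/-- The pseudo-inverse `g*(y) = sup {x ∈ [0,1] | g(x) ≥ y}`. -/
def pseudoInv (g : unitInterval → ℝ) : unitInterval → ℝ :=
  fun y => sSup ((fun x : unitInterval => (x : ℝ)) '' {x | (y : ℝ) ≤ g x})

/-- The normalized integral `(I g)(x) = (∫_x^1 g) / (∫_0^1 g)`. -/
def normInt (g : unitInterval → ℝ) : unitInterval → ℝ :=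
  fun x => integral g x 1 / area g

/-- The operator `T f = I f*`. (For `f ∈ 𝓔` the areas of `f` and `f*` agree.) -/
def T (f : unitInterval → ℝ) : unitInterval → ℝ := normInt (pseudoInv f)

/-- The canonical stribolic iterates `h_n = T^n 1`. -/
def iter (n : ℕ) : unitInterval → ℝ := T^[n] (fun _ => 1)

/-- The function `h = lim h_n`. -/
def h : unitInterval → ℝ := fun x => limUnder atTop (fun n => iter n x)

/-- `g` is a unit stribola: a bijection `[0,1] → [0,1]`, differentiable on `[0,1]` (one-sidedly
at the end points), such that `-γ g' = g⁻¹` on `[0,1]` for some `γ > 0`. -/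
def IsUnitStribola (g : unitInterval → ℝ) : Prop :=
  ∃ e : unitInterval ≃ unitInterval, (∀ x, g x = e x) ∧
    ∃ γ : ℝ, 0 < γ ∧ ∃ g' : unitInterval → ℝ,
      (∀ x : unitInterval, HasDerivWithinAt (IccExtend (zero_le_one : (0 : ℝ) ≤ 1) g) (g' x)
        (Icc 0 1) (x : ℝ)) ∧
      ∀ x : unitInterval, -γ * g' x = e.symm x

end

end Stribola

/-!
For `f ∈ E` the layer-cake formula turns `∫_x^1 f*` into the excess integral
`∫ (f - x)⁺` (`integral_pseudoInv`), so `T f x = ∫ (f - x)⁺ / ∫ f` and the pseudo-inverse disappears.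

The argument rests on an order that ignores scale. Extend members of `E` by `0`, and say that `f`
precedes `g` if no rescaling `c * g (μ * ·)` of `g` is above `f`, then below, then above again
(`ScaleLE`). Since excess integrals create no new sign changes of this kind
(`not_excess_pattern`), and since a rescaling of `T g` is the excess of a rescaling of `g`, the
operator `T` preserves this order (`ScaleLE.T`). Every `f ∈ E` precedes the constant `1`
(`scaleLE_one`). For continuous `g`, positive on `[0,1)`, `f` preceding `g` forces `f / g` to
decrease, in particular `f ≤ g` (`ScaleLE.single_crossing`, `ScaleLE.le`).

Hence the iterates `iter n` decrease pointwise. The bound `T f x ≥ 1 - x / area f` yields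
`a n ≤ 32 * a (n + 1) * a (n + 2)` for the areas `a n` of the iterates; as the `a n` decrease, they
stay above `1 / 32` (`le_area_iter`). So the iterates are uniformly Lipschitz from `n = 1` on, their
limit `h` is continuous, convergence is uniform by Dini's theorem, and `T h = h` by dominated
convergence. Being a value of `T` at a continuous function, `h` decreases strictly from `1` to `0`,
its pseudo-inverse is its inverse, and the fundamental theorem of calculus gives
`-(area h) * h' = h⁻¹`.

A periodic point `g` precedes the iterates along a subsequence, hence precedes `h`. Then `g` crosses
the multiple of `h` that has the same area only once, from above to below, and the cut criterion for
convex functions (`excess_le_of_single_crossing`) gives `T g x ≥ h (λ x)` with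
`λ = area h / area g ≥ 1` (`zeroExt_h_le_T`). Integrating, `area (T g) ≥ area g`, with strict
inequality unless `g = h` (`area_lt_area_T`). Along a periodic orbit the area cannot increase
strictly, so `g = h`.
-/

namespace Stribola

open MeasureTheory

noncomputable section

/-! ### Profiles on the line and their excess integrals -/

/-- The extension of a function on `[0,1]` to the real line by `0`. -/
def zeroExt (f : unitInterval → ℝ) : ℝ → ℝ :=
  (Icc (0 : ℝ) 1).indicator (IccExtend (zero_le_one : (0 : ℝ) ≤ 1) f)

/-- A nonnegative integrable function on the line that vanishes on the negative half-line and
decreases on `[0,∞)`. -/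
structure IsProfile (f : ℝ → ℝ) : Prop where
  nonneg : ∀ t, 0 ≤ f t
  eq_zero : ∀ t < 0, f t = 0
  antitone : AntitoneOn f (Ici 0)
  integrable : Integrable f

/-- The integral `∫ (f - x)⁺` of the part of `f` above the level `x`. -/
def excess (f : ℝ → ℝ) (x : ℝ) : ℝ := ∫ t, max (f t - x) 0

/-- The scaling order: no rescaling `c * g (μ * ·)` of `g` lies above `f`, then below `f`, then
above `f` again. -/
def ScaleLE (f g : ℝ → ℝ) : Prop :=
  ∀ c μ : ℝ, 0 < c → 0 < μ → ∀ t₁ t₂ t₃ : ℝ, t₁ < t₂ → t₂ < t₃ →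
    f t₁ < c * g (μ * t₁) → c * g (μ * t₂) < f t₂ → ¬ f t₃ < c * g (μ * t₃)

theorem IsProfile.nonneg_of_pos {f : ℝ → ℝ} (hf : IsProfile f) {t : ℝ} (ht : 0 < f t) :
    0 ≤ t := by
  by_contra! h
  exact ht.ne' (hf.eq_zero t h)

theorem IsProfile.lt_of_lt {f : ℝ → ℝ} (hf : IsProfile f) {s t : ℝ} (ht : 0 ≤ t)
    (h : f t < f s) : s < t := by
  by_contra! hle
  exact absurd (hf.antitone (mem_Ici.2 ht) (mem_Ici.2 (ht.trans hle)) hle) (not_le.2 h)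

theorem IsProfile.scale {f : ℝ → ℝ} (hf : IsProfile f) {c μ : ℝ} (hc : 0 < c) (hμ : 0 < μ) :
    IsProfile (fun t => c * f (μ * t)) where
  nonneg t := mul_nonneg hc.le (hf.nonneg _)
  eq_zero t ht := by rw [hf.eq_zero _ (mul_neg_of_pos_of_neg hμ ht), mul_zero]
  antitone s hs t ht hst := by
    have := hf.antitone (mem_Ici.2 (mul_nonneg hμ.le hs)) (mem_Ici.2 (mul_nonneg hμ.le ht))
      (mul_le_mul_of_nonneg_left hst hμ.le)
    exact mul_le_mul_of_nonneg_left this hc.le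
  integrable := (hf.integrable.comp_mul_left' hμ.ne').const_mul c

theorem IsProfile.integrable_excess {f : ℝ → ℝ} (hf : IsProfile f) {x : ℝ} (hx : 0 ≤ x) :
    Integrable (fun t => max (f t - x) 0) := by
  refine hf.integrable.mono
    ((hf.integrable.aestronglyMeasurable.sub aestronglyMeasurable_const).sup
      aestronglyMeasurable_const) (Eventually.of_forall fun t => ?_)
  rw [Real.norm_of_nonneg (le_max_right _ _), Real.norm_of_nonneg (hf.nonneg t)]
  exact max_le (by linarith) (hf.nonneg t)

theorem excess_zero {f : ℝ → ℝ} (hf : IsProfile f) : excess f 0 = ∫ t, f t := by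
  refine integral_congr_ae (Eventually.of_forall fun t => ?_)
  simp [hf.nonneg t]

theorem excess_nonneg (f : ℝ → ℝ) (x : ℝ) : 0 ≤ excess f x :=
  integral_nonneg fun _ => le_max_right _ _

theorem excess_antitone {f : ℝ → ℝ} (hf : IsProfile f) {x y : ℝ} (hx : 0 ≤ x) (hxy : x ≤ y) :
    excess f y ≤ excess f x :=
  integral_mono (hf.integrable_excess (hx.trans hxy)) (hf.integrable_excess hx)
    fun t => max_le_max (by linarith) le_rfl

theorem excess_scale (f : ℝ → ℝ) {c μ : ℝ} (hc : 0 < c) (hμ : 0 < μ) (x : ℝ) :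
    excess (fun t => c * f (μ * t)) x = c / μ * excess f (x / c) := by
  have h1 : ∀ t, max (c * f (μ * t) - x) 0 = c * max (f (μ * t) - x / c) 0 := by
    intro t
    rw [mul_max_of_nonneg _ _ hc.le, mul_zero, mul_sub, mul_div_cancel₀ x hc.ne']
  unfold excess
  simp_rw [h1]
  rw [integral_const_mul, Measure.integral_comp_mul_left (fun s => max (f s - x / c) 0) μ,
    abs_of_pos (inv_pos.2 hμ), smul_eq_mul]
  ring

theorem exists_lt_of_integral_lt {F G : ℝ → ℝ} (hF : Integrable F) (hG : Integrable G)
    (h : ∫ t, F t < ∫ t, G t) : ∃ t, F t < G t := by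
  by_contra! hle
  exact absurd (integral_mono hG hF hle) (not_le.2 h)

/-- If `k` has the larger excess over `x`, then somewhere `k` is above both `f` and `x`. -/
theorem exists_of_excess_lt {f k : ℝ → ℝ} (hf : IsProfile f) (hk : IsProfile k) {x : ℝ}
    (hx : 0 ≤ x) (h : excess f x < excess k x) : ∃ t, f t < k t ∧ x < k t := by
  obtain ⟨t, ht⟩ :=
    exists_lt_of_integral_lt (hf.integrable_excess hx) (hk.integrable_excess hx) h
  refine ⟨t, ?_⟩
  have h1 : 0 < k t - x := by
    by_contra! hle
    rw [max_eq_right hle] at ht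
    exact absurd (le_max_right _ _) (not_le.2 ht)
  rw [max_eq_left h1.le] at ht
  have := (le_max_left (f t - x) 0).trans_lt ht
  constructor <;> linarith

/-- If the mass of `k` between the levels `x` and `y` exceeds that of `f`, then somewhere `k` is
above both `f` and `x` while `f` is below `y`. -/
theorem exists_of_excess_sub_lt {f k : ℝ → ℝ} (hf : IsProfile f) (hk : IsProfile k) {x y : ℝ}
    (hx : 0 ≤ x) (hxy : x ≤ y) (h : excess f x - excess f y < excess k x - excess k y) :
    ∃ t, f t < k t ∧ x < k t ∧ f t < y := by
  have hy := hx.trans hxy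
  unfold excess at h
  rw [← integral_sub (hf.integrable_excess hx) (hf.integrable_excess hy),
    ← integral_sub (hk.integrable_excess hx) (hk.integrable_excess hy)] at h
  obtain ⟨t, ht⟩ := exists_lt_of_integral_lt
    ((hf.integrable_excess hx).sub (hf.integrable_excess hy))
    ((hk.integrable_excess hx).sub (hk.integrable_excess hy)) h
  refine ⟨t, ?_⟩
  simp only [Pi.sub_apply] at ht
  rcases max_cases (f t - x) 0 with h1 | h1 <;> rcases max_cases (f t - y) 0 with h2 | h2 <;>
  rcases max_cases (k t - x) 0 with h3 | h3 <;> rcases max_cases (k t - y) 0 with h4 | h4 <;>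
  rw [h1.1, h2.1, h3.1, h4.1] at ht <;> refine ⟨?_, ?_, ?_⟩ <;> linarith

/-- Passing to excess integrals does not create the sign pattern `-, +, -`. The three witnesses
for `f - k` come from the mass above `x₃`, between `x₂` and `x₃`, and between `x₁` and `x₂`;
monotonicity puts them in order. -/
theorem not_excess_pattern {f k : ℝ → ℝ} (hf : IsProfile f) (hk : IsProfile k)
    (h : ∀ t₁ t₂ t₃ : ℝ, t₁ < t₂ → t₂ < t₃ → f t₁ < k t₁ → k t₂ < f t₂ → ¬ f t₃ < k t₃)
    {x₁ x₂ x₃ : ℝ} (hx₁ : 0 ≤ x₁) (h₁₂ : x₁ < x₂) (h₂₃ : x₂ < x₃)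
    (h1 : excess f x₁ < excess k x₁) (h2 : excess k x₂ < excess f x₂) :
    ¬ excess f x₃ < excess k x₃ := by
  intro h3
  have hx₂ := hx₁.trans h₁₂.le
  obtain ⟨s, hs, hs'⟩ := exists_of_excess_lt hf hk (hx₂.trans h₂₃.le) h3
  obtain ⟨t, ht, ht', ht''⟩ := exists_of_excess_sub_lt hk hf hx₂ h₂₃.le (by linarith)
  obtain ⟨u, hu, hu', hu''⟩ := exists_of_excess_sub_lt hf hk hx₁ h₁₂.le (by linarith)
  exact h s t u (hk.lt_of_lt (hf.nonneg_of_pos ((hk.nonneg t).trans_lt ht)) (ht''.trans hs'))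
    (hf.lt_of_lt (hk.nonneg_of_pos ((hf.nonneg u).trans_lt hu)) (hu''.trans ht')) hs ht hu

/-- The cut criterion: if `f - k` changes sign at most once, from `+` to `-`, and `f` and `k` have
the same integral, then `f` has the larger excess over every level. -/
theorem excess_le_of_single_crossing {f k : ℝ → ℝ} (hf : IsProfile f) (hk : IsProfile k)
    (h : ∀ s t : ℝ, s < t → f s < k s → ¬ k t < f t) (hfk : ∫ t, f t = ∫ t, k t)
    {x : ℝ} (hx : 0 ≤ x) : excess k x ≤ excess f x := by
  by_contra! hlt
  rw [← excess_zero hf, ← excess_zero hk] at hfk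
  obtain ⟨s, hs, hs'⟩ := exists_of_excess_lt hf hk hx hlt
  obtain ⟨t, ht, -, ht''⟩ := exists_of_excess_sub_lt hk hf le_rfl hx (by linarith)
  exact h s t (hk.lt_of_lt (hf.nonneg_of_pos ((hk.nonneg t).trans_lt ht)) (ht''.trans hs')) hs ht

theorem ScaleLE.of_tendsto {f g : ℝ → ℝ} {G : ℕ → ℝ → ℝ}
    (hG : ∀ t, Tendsto (fun n => G n t) atTop (𝓝 (g t))) (h : ∀ n, ScaleLE f (G n)) :
    ScaleLE f g := by
  intro c μ hc hμ t₁ t₂ t₃ h₁₂ h₂₃ h1 h2 h3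
  have key := fun t => (hG (μ * t)).const_mul c
  obtain ⟨n, hn1, hn2, hn3⟩ := (((key t₁).eventually (lt_mem_nhds h1)).and
    (((key t₂).eventually (gt_mem_nhds h2)).and
      ((key t₃).eventually (lt_mem_nhds h3)))).exists
  exact h n c μ hc hμ t₁ t₂ t₃ h₁₂ h₂₃ hn1 hn2 hn3

/-! ### Extension by zero -/

theorem zeroExt_coe (f : unitInterval → ℝ) (x : unitInterval) : zeroExt f x = f x := by
  rw [zeroExt, indicator_of_mem x.2, IccExtend_val]

theorem zeroExt_of_notMem (f : unitInterval → ℝ) {t : ℝ} (ht : t ∉ Icc (0 : ℝ) 1) :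
    zeroExt f t = 0 := indicator_of_notMem ht _

theorem integral_zeroExt (f : unitInterval → ℝ) : ∫ t, zeroExt f t = area f := by
  rw [zeroExt, integral_indicator measurableSet_Icc, area, integral,
    intervalIntegral.integral_of_le (by simp), integral_Icc_eq_integral_Ioc]
  simp

theorem isProfile_zeroExt {f : unitInterval → ℝ} (hf : f ∈ E) : IsProfile (zeroExt f) where
  nonneg t := indicator_nonneg (fun _ _ => hf.2.1 _) t
  eq_zero t ht := zeroExt_of_notMem f fun h => absurd h.1 (not_le.2 ht)
  antitone s hs t ht hst := by
    by_cases h1 : t ≤ 1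
    · have := hf.2.2.1 (show (⟨s, hs, hst.trans h1⟩ : unitInterval) ≤ ⟨t, ht, h1⟩ from hst)
      rw [← zeroExt_coe f, ← zeroExt_coe f] at this
      exact this
    · rw [zeroExt_of_notMem f fun h => h1 h.2]
      exact indicator_nonneg (fun _ _ => hf.2.1 _) s
  integrable := by
    refine (integrable_indicator_iff measurableSet_Icc).2 ?_
    refine AntitoneOn.integrableOn_isCompact isCompact_Icc fun s _ t _ hst => ?_
    exact hf.2.2.1 (monotone_projIcc _ hst)

theorem zeroExt_le_one {f : unitInterval → ℝ} (hf : f ∈ E) (t : ℝ) : zeroExt f t ≤ 1 := by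
  by_cases h : t ∈ Icc (0 : ℝ) 1
  · have := hf.2.2.1 (show (0 : unitInterval) ≤ ⟨t, h⟩ from h.1)
    rw [hf.2.2.2.1, ← zeroExt_coe f] at this
    exact this
  · rw [zeroExt_of_notMem f h]; exact zero_le_one

theorem area_mono {f g : unitInterval → ℝ} (hf : f ∈ E) (hg : g ∈ E) (h : ∀ x, f x ≤ g x) :
    area f ≤ area g := by
  rw [← integral_zeroExt, ← integral_zeroExt]
  exact integral_mono (isProfile_zeroExt hf).integrable (isProfile_zeroExt hg).integrable
    fun t => indicator_le_indicator (h _)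

theorem excess_eq_zero {f : unitInterval → ℝ} (hf : f ∈ E) {x : ℝ} (hx : 1 ≤ x) :
    excess (zeroExt f) x = 0 := by
  have : ∀ t, max (zeroExt f t - x) 0 = 0 := fun t =>
    max_eq_right (by linarith [zeroExt_le_one hf t])
  simp [excess, this]

/-- The excess integral is `1`-Lipschitz in the level. -/
theorem excess_le_add {f : unitInterval → ℝ} (hf : f ∈ E) {x y : ℝ} (hx : 0 ≤ x)
    (hxy : x ≤ y) : excess (zeroExt f) x ≤ excess (zeroExt f) y + (y - x) := by
  have hp := isProfile_zeroExt hf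
  have hi : Integrable ((Icc (0 : ℝ) 1).indicator fun _ => y - x) :=
    (integrable_indicator_iff measurableSet_Icc).2 (by simp [integrableOn_const_iff])
  have h1 : ∫ t, (Icc (0 : ℝ) 1).indicator (fun _ => y - x) t = y - x := by
    rw [integral_indicator measurableSet_Icc]; simp
  rw [← h1]
  unfold excess
  rw [← integral_add (hp.integrable_excess (hx.trans hxy)) hi]
  refine integral_mono (hp.integrable_excess hx)
    ((hp.integrable_excess (hx.trans hxy)).add hi) fun t => ?_
  by_cases h : t ∈ Icc (0 : ℝ) 1
  · simp only [indicator_of_mem h]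
    exact max_le (by linarith [le_max_left (zeroExt f t - y) 0])
      (by linarith [le_max_right (zeroExt f t - y) 0])
  · simp only [indicator_of_notMem h, zeroExt_of_notMem f h, add_zero]
    exact max_le_iff.2 ⟨by simp [hx], le_max_right _ _⟩

/-! ### The operator `T` through excess integrals -/

/-- On the unit interval the superlevel set of a decreasing function is an initial segment, whose
length is the value of the pseudo-inverse. -/
theorem volume_superlevel {f : unitInterval → ℝ} (hf : f ∈ E) (y : unitInterval) (hy : 0 < y) :
    volume.real {t | (y : ℝ) ≤ zeroExt f t} = pseudoInv f y := by
  set S : Set ℝ := (fun x : unitInterval => (x : ℝ)) '' {x | (y : ℝ) ≤ f x} with hS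
  have hbdd : BddAbove S := ⟨1, by rintro _ ⟨x, -, rfl⟩; exact x.2.2⟩
  have h0 : (0 : ℝ) ∈ S := ⟨0, by simpa [hf.2.2.2.1] using y.2.2, rfl⟩
  have hs : 0 ≤ sSup S := le_csSup hbdd h0
  have hset : {t | (y : ℝ) ≤ zeroExt f t} = S := by
    ext t
    constructor
    · intro ht
      have hmem : t ∈ Icc (0 : ℝ) 1 := by
        by_contra hn
        have ht' : (y : ℝ) ≤ zeroExt f t := ht
        rw [zeroExt_of_notMem f hn] at ht'
        exact absurd ht' (not_le.2 hy)
      refine ⟨⟨t, hmem⟩, ?_, rfl⟩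
      rw [mem_ofPred_eq, ← zeroExt_coe f]
      exact ht
    · rintro ⟨x, hx, rfl⟩
      rw [mem_ofPred_eq, zeroExt_coe]
      exact hx
  have h1 : S ⊆ Icc 0 (sSup S) := by
    rintro _ ⟨x, hx, rfl⟩
    exact ⟨x.2.1, le_csSup hbdd ⟨x, hx, rfl⟩⟩
  have h2 : Ico 0 (sSup S) ⊆ S := by
    intro t ht
    obtain ⟨_, ⟨x, hx, rfl⟩, htx⟩ := exists_lt_of_lt_csSup ⟨0, h0⟩ ht.2
    have ht1 : t ≤ 1 := htx.le.trans x.2.2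
    exact ⟨⟨t, ht.1, ht1⟩, le_trans hx
      (hf.2.2.1 (show (⟨t, ht.1, ht1⟩ : unitInterval) ≤ x from htx.le)), rfl⟩
  have hv : volume S = ENNReal.ofReal (sSup S) := by
    refine le_antisymm ((measure_mono h1).trans (by simp)) (le_trans (by simp) (measure_mono h2))
  rw [hset, measureReal_def, hv, ENNReal.toReal_ofReal hs]
  rfl

theorem integral_pseudoInv {f : unitInterval → ℝ} (hf : f ∈ E) (x : unitInterval) :
    integral (pseudoInv f) x 1 = excess (zeroExt f) x := by
  have hp := isProfile_zeroExt hf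
  have hx0 : (0 : ℝ) ≤ x := x.2.1
  have hx1 : (x : ℝ) ≤ 1 := x.2.2
  rw [excess, (hp.integrable_excess x.2.1).integral_eq_integral_meas_le
    (Eventually.of_forall fun _ => le_max_right _ _)]
  have hset : ∀ s > 0, {t | s ≤ max (zeroExt f t - x) 0} = {t | s + x ≤ zeroExt f t} := by
    intro s hs
    ext t
    simp only [mem_ofPred_eq, le_max_iff, not_le.2 hs, or_false, le_sub_iff_add_le]
  have h1 : ∫ s in Ioi (0 : ℝ), volume.real {t | s ≤ max (zeroExt f t - x) 0} =
      ∫ s in Ioc (0 : ℝ) (1 - x), volume.real {t | s ≤ max (zeroExt f t - x) 0} := by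
    refine (setIntegral_eq_of_subset_of_forall_sdiff_eq_zero measurableSet_Ioi
      Ioc_subset_Ioi_self fun s hs => ?_)
    have hs' : 1 < s + x := by
      by_contra! hle
      exact hs.2 ⟨hs.1, by linarith⟩
    rw [hset s hs.1]
    have : {t | s + x ≤ zeroExt f t} = ∅ := by
      ext t
      simp only [mem_ofPred_eq, mem_empty_iff_false, iff_false, not_le]
      exact (zeroExt_le_one hf t).trans_lt hs'
    simp [this]
  have h2 : ∫ s in Ioc (0 : ℝ) (1 - x), volume.real {t | s ≤ max (zeroExt f t - x) 0} =
      ∫ s in Ioc (0 : ℝ) (1 - x), IccExtend (zero_le_one : (0 : ℝ) ≤ 1) (pseudoInv f) (s + x) := by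
    refine setIntegral_congr_fun measurableSet_Ioc fun s hs => ?_
    have hmem : s + x ∈ Icc (0 : ℝ) 1 := ⟨by linarith [hs.1], by linarith [hs.2]⟩
    rw [hset s hs.1, IccExtend_of_mem _ _ hmem,
      ← volume_superlevel hf ⟨s + x, hmem⟩ (show (0 : ℝ) < s + x by linarith [hs.1])]
  rw [h1, h2, ← intervalIntegral.integral_of_le (by linarith),
    intervalIntegral.integral_comp_add_right (fun s =>
      IccExtend (zero_le_one : (0 : ℝ) ≤ 1) (pseudoInv f) s), integral]
  simp

theorem area_pseudoInv {f : unitInterval → ℝ} (hf : f ∈ E) : area (pseudoInv f) = area f := by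
  rw [area, integral_pseudoInv hf 0, ← integral_zeroExt]
  exact excess_zero (isProfile_zeroExt hf)

theorem T_apply {f : unitInterval → ℝ} (hf : f ∈ E) (x : unitInterval) :
    T f x = excess (zeroExt f) x / area f := by
  rw [T, normInt, integral_pseudoInv hf, area_pseudoInv hf]

theorem zeroExt_T {f : unitInterval → ℝ} (hf : f ∈ E) {x : ℝ} (hx : 0 ≤ x) :
    zeroExt (T f) x = excess (zeroExt f) x / area f := by
  by_cases h : x ≤ 1
  · rw [← T_apply hf ⟨x, hx, h⟩, ← zeroExt_coe (T f)]
  · rw [zeroExt_of_notMem _ fun h' => h h'.2, excess_eq_zero hf (not_le.1 h).le, zero_div]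

theorem T_zero {f : unitInterval → ℝ} (hf : f ∈ E) : T f 0 = 1 := by
  rw [T_apply hf, ← integral_zeroExt, ← excess_zero (isProfile_zeroExt hf)]
  refine div_self (ne_of_gt ?_)
  change 0 < excess (zeroExt f) 0
  rw [excess_zero (isProfile_zeroExt hf), integral_zeroExt]
  exact hf.2.2.2.2

theorem T_antitone {f : unitInterval → ℝ} (hf : f ∈ E) : Antitone (T f) := by
  intro x y hxy
  rw [T_apply hf, T_apply hf]
  exact div_le_div_of_nonneg_right (excess_antitone (isProfile_zeroExt hf) x.2.1 hxy)
    hf.2.2.2.2.le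

theorem T_lipschitz {f : unitInterval → ℝ} (hf : f ∈ E) (x y : unitInterval) :
    T f x ≤ T f y + (area f)⁻¹ * dist x y := by
  have ha := hf.2.2.2.2
  rcases le_total x y with h | h
  · rw [T_apply hf, T_apply hf, ← div_eq_inv_mul, ← add_div, dist_comm, Subtype.dist_eq,
      Real.dist_eq, abs_of_nonneg (sub_nonneg.2 (show (x : ℝ) ≤ y from h))]
    exact div_le_div_of_nonneg_right (excess_le_add hf x.2.1 h) ha.le
  · exact (T_antitone hf h).trans
      (le_add_of_nonneg_right (mul_nonneg (inv_nonneg.2 ha.le) dist_nonneg))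

theorem continuous_T {f : unitInterval → ℝ} (hf : f ∈ E) : Continuous (T f) :=
  (LipschitzWith.of_le_add_mul (Real.toNNReal (area f)⁻¹) fun x y => by
    rw [Real.coe_toNNReal _ (inv_nonneg.2 hf.2.2.2.2.le)]
    exact T_lipschitz hf x y).continuous

theorem area_pos {f : unitInterval → ℝ} (hc : Continuous f) (h0 : ∀ x, 0 ≤ f x) (h1 : f 0 = 1) :
    0 < area f := by
  rw [area, integral]
  refine intervalIntegral.integral_pos (by simp) (hc.Icc_extend' ).continuousOn
    (fun _ _ => h0 _) ⟨0, by simp, ?_⟩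
  have : IccExtend (zero_le_one : (0 : ℝ) ≤ 1) f ((0 : unitInterval) : ℝ) = f 0 :=
    IccExtend_val _ _ _
  rw [h1] at this
  exact one_pos.trans_eq this.symm

theorem T_mem {f : unitInterval → ℝ} (hf : f ∈ E) : T f ∈ E := by
  have h0 : ∀ x, 0 ≤ T f x := fun x => by
    rw [T_apply hf]
    exact div_nonneg (excess_nonneg _ _) hf.2.2.2.2.le
  exact ⟨(continuous_T hf).measurable, h0, T_antitone hf, T_zero hf,
    area_pos (continuous_T hf) h0 (T_zero hf)⟩

theorem iterate_T_mem {f : unitInterval → ℝ} (hf : f ∈ E) (n : ℕ) : T^[n] f ∈ E := by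
  induction n with
  | zero => exact hf
  | succ n ih => rw [Function.iterate_succ_apply']; exact T_mem ih

/-- `T` preserves the scaling order: a rescaling of `T g` is, up to a factor, the excess integral
of a rescaling of `g`. -/
theorem ScaleLE.T {f g : unitInterval → ℝ} (hf : f ∈ E) (hg : g ∈ E)
    (h : ScaleLE (zeroExt f) (zeroExt g)) : ScaleLE (zeroExt (T f)) (zeroExt (T g)) := by
  have hpf := isProfile_zeroExt hf
  have hpg := isProfile_zeroExt hg
  have ha := hf.2.2.2.2
  have hb := hg.2.2.2.2
  intro c μ hc hμ x₁ x₂ x₃ h₁₂ h₂₃ h1 h2 h3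
  have hx₁ : 0 ≤ x₁ := by
    by_contra! hneg
    rw [(isProfile_zeroExt (T_mem hf)).eq_zero _ hneg,
      (isProfile_zeroExt (T_mem hg)).eq_zero _ (mul_neg_of_pos_of_neg hμ hneg), mul_zero] at h1
    exact lt_irrefl _ h1
  -- `d` absorbs the two normalizing areas
  set d := c * area f / area g with hd
  have hdpos : 0 < d := by positivity
  have hμ' : 0 < μ⁻¹ := inv_pos.2 hμ
  have hdμ : 0 < (d * μ)⁻¹ := by positivity
  have hk := hpg.scale hμ' hdμ
  have key : ∀ x, 0 ≤ x → c * zeroExt (Stribola.T g) (μ * x) * area f =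
      excess (fun t => μ⁻¹ * zeroExt g ((d * μ)⁻¹ * t)) x := by
    intro x hx
    rw [zeroExt_T hg (by positivity), excess_scale _ hμ' hdμ, hd, div_inv_eq_mul x μ, mul_comm x μ]
    field_simp
  have key' : ∀ x, 0 ≤ x → zeroExt (Stribola.T f) x * area f = excess (zeroExt f) x := by
    intro x hx
    rw [zeroExt_T hf hx, div_mul_cancel₀ _ ha.ne']
  have hx₂ := hx₁.trans h₁₂.le
  have hx₃ := hx₂.trans h₂₃.le
  rw [← mul_lt_mul_iff_left₀ ha, key' _ hx₁, key _ hx₁] at h1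
  rw [← mul_lt_mul_iff_left₀ ha, key' _ hx₂, key _ hx₂] at h2
  rw [← mul_lt_mul_iff_left₀ ha, key' _ hx₃, key _ hx₃] at h3
  exact not_excess_pattern hpf hk (h _ _ hμ' hdμ) hx₁ h₁₂ h₂₃ h1 h2 h3

/-! ### Quantitative bounds -/

/-- The mass of `f` between the levels `x` and `y` is at least that of the rectangle over
`[0, δ]`. -/
theorem mul_le_excess_sub {f : unitInterval → ℝ} (hf : f ∈ E) (δ : unitInterval) {x y : ℝ}
    (hx : 0 ≤ x) (hxy : x ≤ y) :
    δ * (min (f δ) y - x) ≤ excess (zeroExt f) x - excess (zeroExt f) y := by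
  have hp := isProfile_zeroExt hf
  have hδ : (0 : ℝ) ≤ δ := δ.2.1
  have hi : Integrable ((Icc (0 : ℝ) δ).indicator fun _ => min (f δ) y - x) :=
    (integrable_indicator_iff measurableSet_Icc).2 (by simp [integrableOn_const_iff])
  have h1 : ∫ t, (Icc (0 : ℝ) δ).indicator (fun _ => min (f δ) y - x) t =
      δ * (min (f δ) y - x) := by
    rw [integral_indicator measurableSet_Icc]; simp [hδ]
  unfold excess
  rw [← h1, ← integral_sub (hp.integrable_excess hx) (hp.integrable_excess (hx.trans hxy))]
  refine integral_mono hi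
    ((hp.integrable_excess hx).sub (hp.integrable_excess (hx.trans hxy))) fun t => ?_
  simp only
  by_cases h : t ∈ Icc (0 : ℝ) δ
  · have h2 : f δ ≤ zeroExt f t := by
      rw [← zeroExt_coe f]
      exact hp.antitone h.1 hδ h.2
    rw [indicator_of_mem h]
    rcases le_total y (zeroExt f t) with h3 | h3
    · rw [max_eq_left (by linarith), max_eq_left (by linarith)]
      linarith [min_le_right (f δ) y]
    · rw [max_eq_right (by linarith : zeroExt f t - y ≤ 0)]
      linarith [min_le_left (f δ) y, le_max_left (zeroExt f t - x) 0]
  · rw [indicator_of_notMem h]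
    exact sub_nonneg.2 (max_le_max (by linarith) le_rfl)

theorem mul_le_excess {f : unitInterval → ℝ} (hf : f ∈ E) (δ : unitInterval) {x : ℝ}
    (hx : 0 ≤ x) : δ * (f δ - x) ≤ excess (zeroExt f) x := by
  rcases le_total x 1 with h | h
  · have := mul_le_excess_sub hf δ hx h
    rwa [excess_eq_zero hf le_rfl, sub_zero, min_eq_left] at this
    rw [← zeroExt_coe f]
    exact zeroExt_le_one hf _
  · refine le_trans (mul_nonpos_of_nonneg_of_nonpos δ.2.1 ?_) (excess_nonneg _ _)
    rw [← zeroExt_coe f]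
    linarith [zeroExt_le_one hf δ]

theorem mul_le_area {f : unitInterval → ℝ} (hf : f ∈ E) (δ : unitInterval) :
    δ * f δ ≤ area f := by
  have := mul_le_excess hf δ le_rfl
  rwa [sub_zero, excess_zero (isProfile_zeroExt hf), integral_zeroExt] at this

/-- Near `0`, a continuous member of `E` exceeds every level below `1`. -/
theorem exists_pos_lt {f : unitInterval → ℝ} (hf : f ∈ E) (hc : Continuous f) {y : ℝ}
    (hy : y < 1) : ∃ δ : unitInterval, 0 < δ ∧ y < f δ := by
  have h1 : ∀ᶠ x in 𝓝 (0 : unitInterval), y < f x :=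
    hc.continuousAt.eventually (lt_mem_nhds (by rwa [hf.2.2.2.1]))
  have h2 : (𝓝[>] (0 : unitInterval)).NeBot :=
    nhdsGT_neBot_of_exists_gt ⟨1, zero_lt_one⟩
  obtain ⟨δ, hδ, hδ'⟩ := ((h1.filter_mono nhdsWithin_le_nhds).and
    (self_mem_nhdsWithin : Ioi (0 : unitInterval) ∈ 𝓝[>] 0)).exists
  exact ⟨δ, hδ', hδ⟩

theorem T_strictAnti {f : unitInterval → ℝ} (hf : f ∈ E) (hc : Continuous f) :
    StrictAnti (T f) := by
  intro x y hxy
  have hxy' : (x : ℝ) < y := hxy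
  have hx1 : (x : ℝ) < 1 := hxy'.trans_le y.2.2
  obtain ⟨δ, hδ, hδ'⟩ := exists_pos_lt hf hc hx1
  have h1 := mul_le_excess_sub hf δ x.2.1 hxy'.le
  have h2 : 0 < (δ : ℝ) * (min (f δ) y - x) :=
    mul_pos hδ (sub_pos.2 (lt_min hδ' hxy'))
  rw [T_apply hf, T_apply hf]
  exact div_lt_div_of_pos_right (by linarith) hf.2.2.2.2

theorem T_one {f : unitInterval → ℝ} (hf : f ∈ E) : T f 1 = 0 := by
  rw [T_apply hf, excess_eq_zero hf (by simp), zero_div]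

theorem T_pos {f : unitInterval → ℝ} (hf : f ∈ E) (hc : Continuous f) (x : unitInterval)
    (hx : x < 1) : 0 < T f x := by
  rw [← T_one hf]
  exact T_strictAnti hf hc hx

theorem area_le_one {f : unitInterval → ℝ} (hf : f ∈ E) : area f ≤ 1 := by
  have h := excess_le_add hf le_rfl zero_le_one
  rw [excess_eq_zero hf le_rfl, excess_zero (isProfile_zeroExt hf), integral_zeroExt] at h
  linarith

/-- Two steps of `T` cannot lose area indefinitely: `T f` is at least `1 - x / area f`, which
bounds the area of the next iterate from below. -/
theorem area_le_mul_area {f : unitInterval → ℝ} (hf : f ∈ E) :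
    area f ≤ 32 * (area (T f) * area (T (T f))) := by
  have ha := hf.2.2.2.2
  have ha1 := area_le_one hf
  have hT := T_mem hf
  have hb := hT.2.2.2.2
  let δ : unitInterval := ⟨area f / 4, by linarith, by linarith⟩
  let m : unitInterval := ⟨1 / 2, by norm_num, by norm_num⟩
  have h1 : 3 / 4 ≤ T f δ := by
    have h := T_lipschitz hf 0 δ
    rw [T_zero hf, dist_comm, Subtype.dist_eq, Real.dist_eq] at h
    have h' : |(δ : ℝ) - ((0 : unitInterval) : ℝ)| = area f / 4 := by
      simp only [δ, Icc.coe_zero, sub_zero]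
      exact abs_of_pos (by linarith)
    rw [h'] at h
    field_simp at h
    linarith
  have h2 := mul_le_excess hT δ (x := 1 / 2) (by norm_num)
  have h3 := mul_le_area (T_mem hT) m
  rw [T_apply hT] at h3
  have h4 : area f / 16 ≤ excess (zeroExt (T f)) (1 / 2) := by
    have : (δ : ℝ) = area f / 4 := rfl
    rw [this] at h2
    nlinarith
  have h5 : excess (zeroExt (T f)) (1 / 2) ≤ 2 * (area (T f) * area (T (T f))) := by
    have : (m : ℝ) = 1 / 2 := rfl
    rw [this, ← mul_div_assoc, div_le_iff₀ hb] at h3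
    linarith
  linarith

/-! ### Consequences of the scaling order -/

theorem one_mem : (fun _ => 1 : unitInterval → ℝ) ∈ E :=
  ⟨measurable_const, fun _ => zero_le_one, antitone_const, rfl,
    area_pos continuous_const (fun _ => zero_le_one) rfl⟩

theorem scaleLE_one {f : unitInterval → ℝ} (hf : f ∈ E) :
    ScaleLE (zeroExt f) (zeroExt fun _ => 1) := by
  have hp := isProfile_zeroExt hf
  have h1 := isProfile_zeroExt one_mem
  intro c μ hc hμ t₁ t₂ t₃ h₁₂ h₂₃ h1' h2 h3
  have hk := h1.scale hc hμ
  have ht₁ : 0 ≤ t₁ := hk.nonneg_of_pos ((hp.nonneg _).trans_lt h1')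
  have ht₂ : 0 ≤ t₂ := ht₁.trans h₁₂.le
  have key : ∀ t, 0 ≤ t → 0 < c * zeroExt (fun _ => 1) (μ * t) →
      μ * t ≤ 1 := by
    intro t ht hpos
    by_contra! hlt
    rw [zeroExt_of_notMem _ fun h => absurd h.2 (not_le.2 hlt), mul_zero] at hpos
    exact lt_irrefl _ hpos
  have hval : ∀ t, 0 ≤ t → μ * t ≤ 1 → zeroExt (fun _ => 1) (μ * t) = 1 := fun t ht ht' =>
    zeroExt_coe (fun _ => 1) ⟨μ * t, by positivity, ht'⟩
  have h4 := key t₃ (ht₂.trans h₂₃.le) ((hp.nonneg _).trans_lt h3)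
  have h5 : μ * t₂ ≤ 1 := (mul_le_mul_of_nonneg_left h₂₃.le hμ.le).trans h4
  rw [hval t₂ ht₂ h5] at h2
  rw [hval t₁ ht₁ ((mul_le_mul_of_nonneg_left h₁₂.le hμ.le).trans h5)] at h1'
  exact absurd (hp.antitone ht₁ ht₂ h₁₂.le) (by linarith)

/-- In the scaling order, `f / g` decreases: no multiple of `g` lies above `f` and then below `f`.
Stretching `g` slightly keeps both inequalities and puts it above `f` once more, beyond `1`. -/
theorem ScaleLE.single_crossing {f g : unitInterval → ℝ}
    (hg : Continuous g) (hpos : ∀ x, x < 1 → 0 < g x)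
    (h : ScaleLE (zeroExt f) (zeroExt g)) {c : ℝ} (hc : 0 < c) {s t : unitInterval}
    (hst : s < t) (h1 : f s < c * g s) : ¬ c * g t < f t := by
  intro h2
  have key : ∀ x : unitInterval,
      Tendsto (fun μ : ℝ => c * IccExtend (zero_le_one : (0 : ℝ) ≤ 1) g (μ * x)) (𝓝[<] 1)
        (𝓝 (c * g x)) := by
    intro x
    have h3 : Continuous fun μ : ℝ =>
        c * IccExtend (zero_le_one : (0 : ℝ) ≤ 1) g (μ * x) :=
      continuous_const.mul (hg.Icc_extend'.comp (continuous_id.mul continuous_const))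
    have h4 := h3.tendsto 1
    rw [one_mul, IccExtend_val] at h4
    exact h4.mono_left nhdsWithin_le_nhds
  have hev : ∀ᶠ μ : ℝ in 𝓝[<] 1, 0 < μ ∧ μ < 1 := Ioo_mem_nhdsLT zero_lt_one
  obtain ⟨μ, hμ1, hμ2, hμ⟩ := (((key s).eventually (lt_mem_nhds h1)).and
    (((key t).eventually (gt_mem_nhds h2)).and hev)).exists
  have hz : ∀ x : unitInterval,
      zeroExt g (μ * x) = IccExtend (zero_le_one : (0 : ℝ) ≤ 1) g (μ * x) := fun x =>
    indicator_of_mem (s := Icc (0 : ℝ) 1)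
      ⟨mul_nonneg hμ.1.le x.2.1, mul_le_one₀ hμ.2.le x.2.1 x.2.2⟩ _
  rw [← hz, ← zeroExt_coe f] at hμ1 hμ2
  obtain ⟨u, hu1, hu2⟩ := exists_between ((one_lt_inv₀ hμ.1).2 hμ.2)
  have hu3 : μ * u < 1 := by
    have := mul_lt_mul_of_pos_left hu2 hμ.1
    rwa [mul_inv_cancel₀ hμ.1.ne'] at this
  refine h c μ hc hμ.1 s t u hst ((show (t : ℝ) ≤ 1 from t.2.2).trans_lt hu1) hμ1 hμ2 ?_
  rw [zeroExt_of_notMem f fun h => absurd h.2 (not_le.2 hu1)]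
  have hmem : μ * u ∈ Icc (0 : ℝ) 1 :=
    ⟨mul_nonneg hμ.1.le (zero_le_one.trans hu1.le), hu3.le⟩
  have := hpos ⟨μ * u, hmem⟩ hu3
  rw [← zeroExt_coe g] at this
  exact mul_pos hc this

theorem ScaleLE.le {f g : unitInterval → ℝ} (hf : f ∈ E) (hg' : g ∈ E)
    (hg : Continuous g) (hpos : ∀ x, x < 1 → 0 < g x)
    (h : ScaleLE (zeroExt f) (zeroExt g)) (x : unitInterval) : f x ≤ g x := by
  by_contra! hlt
  have hx : 0 < x := by
    refine lt_of_le_of_ne x.2.1 fun h0 => ?_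
    rw [← h0, hf.2.2.2.1, hg'.2.2.2.1] at hlt
    exact lt_irrefl _ hlt
  -- a factor slightly above `1` puts the multiple of `g` above `f` at `0`, still below at `x`
  have h1 : ∀ᶠ c in 𝓝[>] (1 : ℝ), c * g x < f x := by
    have : Tendsto (fun c : ℝ => c * g x) (𝓝[>] 1) (𝓝 (1 * g x)) :=
      ((continuous_id.mul continuous_const).tendsto 1).mono_left nhdsWithin_le_nhds
    exact this.eventually (gt_mem_nhds (by rwa [one_mul]))
  obtain ⟨c, hc, hc1⟩ := (h1.and self_mem_nhdsWithin).exists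
  have hc1 : 1 < c := hc1
  refine h.single_crossing hg hpos (zero_lt_one.trans hc1) hx ?_ hc
  rw [hf.2.2.2.1, hg'.2.2.2.1]
  linarith

/-! ### The canonical iterates and their limit -/

theorem iter_succ (n : ℕ) : iter (n + 1) = T (iter n) :=
  Function.iterate_succ_apply' T n _

theorem iter_mem (n : ℕ) : iter n ∈ E := iterate_T_mem one_mem n

theorem continuous_iter : ∀ n, Continuous (iter n)
  | 0 => continuous_const
  | n + 1 => by rw [iter_succ]; exact continuous_T (iter_mem n)

theorem iter_pos : ∀ n x, x < 1 → 0 < iter n x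
  | 0, _, _ => zero_lt_one
  | n + 1, x, hx => by rw [iter_succ]; exact T_pos (iter_mem n) (continuous_iter n) x hx

theorem scaleLE_iterate {f : unitInterval → ℝ} (hf : f ∈ E) (n : ℕ) :
    ScaleLE (zeroExt (T^[n] f)) (zeroExt (iter n)) := by
  induction n with
  | zero => exact scaleLE_one hf
  | succ n ih =>
    rw [iter_succ, Function.iterate_succ_apply']
    exact ih.T (iterate_T_mem hf n) (iter_mem n)

theorem iter_antitone : Antitone iter := by
  refine antitone_nat_of_succ_le fun n x => ?_
  refine ScaleLE.le (iter_mem _) (iter_mem n) (continuous_iter n) (iter_pos n) ?_ x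
  rw [iter, Function.iterate_succ_apply]
  exact scaleLE_iterate (T_mem one_mem) n

theorem le_area_iter (n : ℕ) : 1 / 32 ≤ area (iter n) := by
  -- `a (n + 2) ≤ a n` turns `a n ≤ 32 * (a (n + 1) * a (n + 2))` into a bound on `a (n + 1)`
  have h1 := area_le_mul_area (iter_mem n)
  rw [← iter_succ, ← iter_succ] at h1
  have h2 := area_mono (iter_mem _) (iter_mem n) (iter_antitone (Nat.le_add_right n 2))
  have h3 := area_mono (iter_mem _) (iter_mem n) (iter_antitone (Nat.le_succ n))
  have h4 := (iter_mem (n + 1)).2.2.2.2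
  have h5 := (iter_mem n).2.2.2.2
  have h6 : area (iter n) ≤ 32 * area (iter (n + 1)) * area (iter n) := by
    nlinarith
  have h7 : 1 ≤ 32 * area (iter (n + 1)) := by
    by_contra! hlt
    nlinarith
  have h8 : area (iter (n + 1)) ≤ area (iter n) := h3
  linarith

theorem tendsto_iter (x : unitInterval) : Tendsto (fun n => iter n x) atTop (𝓝 (h x)) :=
  tendsto_nhds_limUnder ⟨_, tendsto_atTop_ciInf (fun _ _ hmn => iter_antitone hmn x)
    ⟨0, by rintro _ ⟨n, rfl⟩; exact (iter_mem n).2.1 x⟩⟩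

theorem tendsto_zeroExt_iter (t : ℝ) :
    Tendsto (fun n => zeroExt (iter n) t) atTop (𝓝 (zeroExt h t)) := by
  by_cases ht : t ∈ Icc (0 : ℝ) 1
  · have := tendsto_iter ⟨t, ht⟩
    simp_rw [← zeroExt_coe] at this
    exact this
  · simp_rw [zeroExt_of_notMem _ ht]
    exact tendsto_const_nhds

theorem continuous_h : Continuous h := by
  refine (LipschitzWith.of_le_add_mul 32 fun x y => ?_).continuous
  refine le_of_tendsto_of_tendsto ((tendsto_add_atTop_iff_nat 1).2 (tendsto_iter x))
    (((tendsto_add_atTop_iff_nat 1).2 (tendsto_iter y)).add_const _)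
    (Eventually.of_forall fun n => ?_)
  simp only [iter_succ]
  refine (T_lipschitz (iter_mem n) x y).trans ?_
  have h1 : (area (iter n))⁻¹ ≤ 32 := by
    rw [inv_le_comm₀ (iter_mem n).2.2.2.2 (by norm_num), ← one_div]
    exact le_area_iter n
  have := mul_le_mul_of_nonneg_right h1 (dist_nonneg (x := x) (y := y))
  simpa using this

theorem h_mem : h ∈ E := by
  have h0 : ∀ x, 0 ≤ h x := fun x => ge_of_tendsto' (tendsto_iter x) fun n => (iter_mem n).2.1 x
  have h1 : h 0 = 1 := by
    refine tendsto_nhds_unique (tendsto_iter 0) ?_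
    simp_rw [(iter_mem _).2.2.2.1]
    exact tendsto_const_nhds
  exact ⟨continuous_h.measurable, h0, fun x y hxy =>
    le_of_tendsto_of_tendsto' (tendsto_iter y) (tendsto_iter x) fun n => (iter_mem n).2.2.1 hxy,
    h1, area_pos continuous_h h0 h1⟩

theorem tendstoUniformly_iter : TendstoUniformly iter h atTop :=
  Antitone.tendstoUniformly_of_forall_tendsto continuous_iter iter_antitone
    continuous_h tendsto_iter

theorem tendsto_excess_iter {x : ℝ} (hx : 0 ≤ x) :
    Tendsto (fun n => excess (zeroExt (iter n)) x) atTop (𝓝 (excess (zeroExt h) x)) := by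
  have hp := fun n => isProfile_zeroExt (iter_mem n)
  refine tendsto_integral_of_dominated_convergence (zeroExt (iter 0))
    (fun n => ((hp n).integrable_excess hx).aestronglyMeasurable) (hp 0).integrable
    (fun n => Eventually.of_forall fun t => ?_) (Eventually.of_forall fun t => ?_)
  · rw [Real.norm_of_nonneg (le_max_right _ _)]
    have h1 : zeroExt (iter n) t ≤ zeroExt (iter 0) t :=
      indicator_le_indicator (iter_antitone (Nat.zero_le n) _)
    exact max_le (by linarith) ((hp 0).nonneg t)
  · exact ((tendsto_zeroExt_iter t).sub_const x).max tendsto_const_nhds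

theorem T_h : T h = h := by
  funext x
  have h1 : Tendsto (fun n => area (iter n)) atTop (𝓝 (area h)) := by
    have := tendsto_excess_iter le_rfl
    simp_rw [excess_zero (isProfile_zeroExt (iter_mem _)),
      excess_zero (isProfile_zeroExt h_mem), integral_zeroExt] at this
    exact this
  have h2 := (tendsto_excess_iter x.2.1).div h1 h_mem.2.2.2.2.ne'
  refine tendsto_nhds_unique ?_ ((tendsto_add_atTop_iff_nat 1).2 (tendsto_iter x))
  simp_rw [iter_succ, T_apply (iter_mem _)]
  rw [T_apply h_mem]
  exact h2

/-! ### The limit is a unit stribola -/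

theorem h_strictAnti : StrictAnti h := by
  rw [← T_h]
  exact T_strictAnti h_mem continuous_h

theorem h_pos (x : unitInterval) (hx : x < 1) : 0 < h x := by
  rw [← T_h]
  exact T_pos h_mem continuous_h x hx

theorem h_one : h 1 = 0 := by
  rw [← T_h]
  exact T_one h_mem

theorem h_mem_Icc (x : unitInterval) : h x ∈ Icc (0 : ℝ) 1 :=
  ⟨h_mem.2.1 x, h_mem.2.2.2.1 ▸ h_mem.2.2.1 x.2.1⟩

theorem bijective_h : Function.Bijective fun x => (⟨h x, h_mem_Icc x⟩ : unitInterval) := by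
  refine ⟨fun x y hxy => h_strictAnti.injective (congrArg Subtype.val hxy), fun y => ?_⟩
  refine mem_range_of_exists_le_of_exists_ge (continuous_h.subtype_mk _) ⟨1, ?_⟩ ⟨0, ?_⟩
  · change h 1 ≤ y
    rw [h_one]
    exact y.2.1
  · change (y : ℝ) ≤ h 0
    rw [h_mem.2.2.2.1]
    exact y.2.2

/-- The limit `h` as a permutation of the unit interval. -/
def hEquiv : unitInterval ≃ unitInterval := Equiv.ofBijective _ bijective_h

theorem coe_hEquiv (x : unitInterval) : (hEquiv x : ℝ) = h x := rfl

theorem pseudoInv_h (y : unitInterval) : pseudoInv h y = hEquiv.symm y := by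
  have h1 : {x | (y : ℝ) ≤ h x} = Iic (hEquiv.symm y) := by
    ext x
    have h2 : (y : ℝ) = h (hEquiv.symm y) := by rw [← coe_hEquiv, Equiv.apply_symm_apply]
    rw [mem_ofPred_eq, h2, h_strictAnti.le_iff_ge, mem_Iic]
  rw [pseudoInv, h1]
  refine IsGreatest.csSup_eq ⟨⟨_, self_mem_Iic, rfl⟩, ?_⟩
  rintro _ ⟨x, hx, rfl⟩
  exact hx

theorem continuous_pseudoInv_h : Continuous (pseudoInv h) := by
  have h1 : Continuous hEquiv := continuous_h.subtype_mk _
  have h2 : Continuous hEquiv.symm := h1.continuous_symm_of_equiv_compact_to_t2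
  rw [funext pseudoInv_h]
  exact continuous_subtype_val.comp h2

theorem isUnitStribola_h : IsUnitStribola h := by
  have ha := h_mem.2.2.2.2
  refine ⟨hEquiv, fun x => rfl, area h, ha, fun x => -(area h)⁻¹ * hEquiv.symm x,
    fun x => ?_, fun x => ?_⟩
  · have hc : Continuous (IccExtend (zero_le_one : (0 : ℝ) ≤ 1) (pseudoInv h)) :=
      continuous_pseudoInv_h.Icc_extend'
    have h1 := (intervalIntegral.integral_hasDerivAt_left (hc.intervalIntegrable (x : ℝ) 1)
      hc.aestronglyMeasurable.stronglyMeasurableAtFilter hc.continuousAt).const_mul (area h)⁻¹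
    rw [IccExtend_val, pseudoInv_h] at h1
    have h2 : ∀ z ∈ Icc (0 : ℝ) 1, IccExtend (zero_le_one : (0 : ℝ) ≤ 1) h z =
        (area h)⁻¹ * ∫ t in z..1, IccExtend (zero_le_one : (0 : ℝ) ≤ 1) (pseudoInv h) t := by
      intro z hz
      rw [IccExtend_of_mem _ _ hz]
      conv_lhs => rw [← T_h]
      rw [T, normInt, area_pseudoInv h_mem, div_eq_inv_mul]
      rfl
    refine (h1.hasDerivWithinAt.congr h2 (h2 x x.2)).congr_deriv ?_
    ring
  · field_simp

/-! ### Periodic points -/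

theorem eq_of_le_of_area_eq {f g : unitInterval → ℝ} (hf : Continuous f) (hg : Continuous g)
    (hle : ∀ x, f x ≤ g x) (ha : area f = area g) : f = g := by
  by_contra hne
  obtain ⟨x, hx⟩ := Function.ne_iff.1 hne
  refine ha.not_lt ?_
  refine intervalIntegral.integral_lt_integral_of_continuousOn_of_le_of_exists_lt (by simp)
    hf.Icc_extend'.continuousOn hg.Icc_extend'.continuousOn (fun _ _ => hle _)
    ⟨x, x.2, ?_⟩
  rw [IccExtend_val, IccExtend_val]
  exact lt_of_le_of_ne (hle x) hx

/-- If `f` precedes `h` in the scaling order, then `T f` dominates the copy of `h` contracted so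
as to have the area of `f`. Indeed `f` crosses the multiple of `h` of equal area only once. -/
theorem zeroExt_h_le_T {f : unitInterval → ℝ} (hf : f ∈ E)
    (hs : ScaleLE (zeroExt f) (zeroExt h)) {t : ℝ} (ht : 0 ≤ t) :
    zeroExt h (area h / area f * t) ≤ zeroExt (T f) t := by
  have ha := hf.2.2.2.2
  have hb := h_mem.2.2.2.2
  have hc : 0 < area f / area h := div_pos ha hb
  have hph := isProfile_zeroExt h_mem
  have hk := hph.scale hc one_pos
  have hint : ∫ t, zeroExt f t = ∫ t, area f / area h * zeroExt h (1 * t) := by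
    simp_rw [one_mul]
    rw [integral_const_mul, integral_zeroExt, integral_zeroExt, div_mul_cancel₀ _ hb.ne']
  have hcross : ∀ s t : ℝ, s < t → zeroExt f s < area f / area h * zeroExt h (1 * s) →
      ¬ area f / area h * zeroExt h (1 * t) < zeroExt f t := by
    intro s t hst h1 h2
    have hs0 : 0 ≤ s := hk.nonneg_of_pos (((isProfile_zeroExt hf).nonneg s).trans_lt h1)
    have ht1 : t ≤ 1 := by
      by_contra! hlt
      rw [zeroExt_of_notMem f fun h' => absurd h'.2 (not_le.2 hlt)] at h2
      exact absurd (hk.nonneg t) (not_le.2 h2)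
    rw [one_mul] at h1 h2
    have e1 := zeroExt_coe f ⟨s, hs0, hst.le.trans ht1⟩
    have e2 := zeroExt_coe h ⟨s, hs0, hst.le.trans ht1⟩
    have e3 := zeroExt_coe f ⟨t, hs0.trans hst.le, ht1⟩
    have e4 := zeroExt_coe h ⟨t, hs0.trans hst.le, ht1⟩
    simp only at e1 e2 e3 e4
    rw [e1, e2] at h1
    rw [e3, e4] at h2
    exact hs.single_crossing continuous_h h_pos hc
      (show (⟨s, hs0, hst.le.trans ht1⟩ : unitInterval) < ⟨t, hs0.trans hst.le, ht1⟩ from hst) h1 h2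
  have key := excess_le_of_single_crossing (isProfile_zeroExt hf) hk hcross hint ht
  rw [excess_scale _ hc one_pos, div_one] at key
  rw [zeroExt_T hf ht, le_div_iff₀ ha]
  have h3 := zeroExt_T h_mem (x := t / (area f / area h)) (by positivity)
  rw [T_h] at h3
  have h4 : area h / area f * t = t / (area f / area h) := by field_simp
  rw [h4, h3]
  refine le_trans (le_of_eq ?_) key
  field_simp

/-- Below `h` in the scaling order, `T` strictly increases the area. -/
theorem area_lt_area_T {f : unitInterval → ℝ} (hf : f ∈ E) (hc : Continuous f)
    (hs : ScaleLE (zeroExt f) (zeroExt h)) (hne : f ≠ h) : area f < area (T f) := by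
  have ha := hf.2.2.2.2
  have hb := h_mem.2.2.2.2
  have hle := hs.le hf h_mem continuous_h h_pos
  have hlt : area f < area h := lt_of_le_of_ne (area_mono hf h_mem hle)
    fun he => hne (eq_of_le_of_area_eq hc continuous_h hle he)
  have hc1 : area f / area h < 1 := (div_lt_one hb).2 hlt
  -- beyond `area f / area h` the contracted copy of `h` vanishes, while `T f` is still positive
  obtain ⟨s, hs1, hs2⟩ := exists_between hc1
  have hs0 : 0 < s := (div_pos ha hb).trans hs1
  have hmem : s ∈ Icc (0 : ℝ) 1 := ⟨hs0.le, hs2.le⟩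
  have hpos : 0 < zeroExt (T f) s := by
    have := T_pos hf hc ⟨s, hmem⟩ hs2
    rwa [← zeroExt_coe (T f)] at this
  have hp := isProfile_zeroExt (T_mem hf)
  have hlam : 0 < area h / area f := div_pos hb ha
  have hi1 : Integrable fun t => zeroExt h (area h / area f * t) :=
    (isProfile_zeroExt h_mem).integrable.comp_mul_left' hlam.ne'
  have hi2 : Integrable ((Ioc (area f / area h) s).indicator fun _ => zeroExt (T f) s) :=
    (integrable_indicator_iff measurableSet_Ioc).2 (by simp [integrableOn_const_iff])
  have key : ∫ t, (zeroExt h (area h / area f * t) +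
      (Ioc (area f / area h) s).indicator (fun _ => zeroExt (T f) s) t) ≤ area (T f) := by
    rw [← integral_zeroExt (T f)]
    refine integral_mono (hi1.add hi2) hp.integrable fun t => ?_
    by_cases hts : t ∈ Ioc (area f / area h) s
    · have h0 : 0 < t := (div_pos ha hb).trans hts.1
      have h1 : 1 < area h / area f * t := by
        have := hts.1
        rw [div_lt_iff₀ hb] at this
        rw [div_mul_eq_mul_div, lt_div_iff₀ ha]
        linarith
      simp only [indicator_of_mem hts]
      rw [zeroExt_of_notMem h fun h' => absurd h'.2 (not_le.2 h1), zero_add]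
      exact hp.antitone h0.le hs0.le hts.2
    · simp only [indicator_of_notMem hts, add_zero]
      rcases lt_or_ge t 0 with h0 | h0
      · rw [(isProfile_zeroExt h_mem).eq_zero _ (mul_neg_of_pos_of_neg hlam h0), hp.eq_zero t h0]
      · exact zeroExt_h_le_T hf hs h0
  rw [integral_add hi1 hi2, Measure.integral_comp_mul_left (fun u => zeroExt h u),
    integral_zeroExt, integral_indicator measurableSet_Ioc, abs_of_pos (inv_pos.2 hlam)] at key
  simp only [integral_const, smul_eq_mul, inv_div, div_mul_cancel₀ _ hb.ne',
    measureReal_restrict_apply_univ, Real.volume_real_Ioc_of_le hs1.le] at key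
  have := mul_pos (sub_pos.2 hs1) hpos
  linarith

/-- A periodic point precedes every `iter (n * r)` in the scaling order, hence also `h`. -/
theorem scaleLE_h_of_periodic {r : ℕ} {g : unitInterval → ℝ} (hr : 1 ≤ r) (hg : g ∈ E)
    (hp : T^[r] g = g) : ScaleLE (zeroExt g) (zeroExt h) := by
  have ht : Tendsto (fun n => r * n) atTop atTop := tendsto_id.const_mul_atTop' hr
  refine ScaleLE.of_tendsto (fun t => (tendsto_zeroExt_iter t).comp ht) fun n => ?_
  have := scaleLE_iterate hg (r * n)
  rwa [Function.iterate_mul, Function.iterate_fixed hp] at this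

theorem eq_h_of_periodic {r : ℕ} {g : unitInterval → ℝ} (hr : 1 ≤ r) (hg : g ∈ E)
    (hp : T^[r] g = g) : g = h := by
  by_contra hne
  have hper : ∀ i, T^[r] (T^[i] g) = T^[i] g := fun i => by
    rw [← Function.iterate_add_apply, add_comm, Function.iterate_add_apply, hp]
  have hmem := iterate_T_mem hg
  have hcont : ∀ i, Continuous (T^[i] g) := fun i => by
    obtain ⟨q, rfl⟩ := Nat.exists_eq_add_of_le' hr
    rw [← hper i, Function.iterate_succ_apply']
    exact continuous_T (iterate_T_mem (hmem i) q)
  have hne' : ∀ i, T^[i] g ≠ h := fun i hi => by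
    refine hne ?_
    obtain ⟨q, rfl⟩ := Nat.exists_eq_add_of_le' hr
    calc g = T^[(q + 1) * i] g := by rw [Function.iterate_mul, Function.iterate_fixed hp]
      _ = T^[q * i] (T^[i] g) := by rw [← Function.iterate_add_apply, Nat.succ_mul]
      _ = h := by rw [hi, Function.iterate_fixed T_h]
  have hmono : StrictMono fun i => area (T^[i] g) := strictMono_nat_of_lt_succ fun i => by
    rw [Function.iterate_succ_apply']
    exact area_lt_area_T (hmem i) (hcont i) (scaleLE_h_of_periodic hr (hmem i) (hper i)) (hne' i)
  have := hmono (show 0 < r from hr)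
  simp only [hp, Function.iterate_zero, id_eq, lt_irrefl] at this

end

end Stribola

theorem mainTheorem2 :
    (TendstoUniformly Stribola.iter Stribola.h atTop ∧
      Stribola.h ∈ Stribola.E ∧
      Stribola.IsUnitStribola Stribola.h ∧
      Stribola.T Stribola.h = Stribola.h) ∧
    ∀ (r : ℕ) (g : unitInterval → ℝ), 1 ≤ r → g ∈ Stribola.E →
      Stribola.T^[r] g = g → g = Stribola.h :=
  ⟨⟨Stribola.tendstoUniformly_iter, Stribola.h_mem, Stribola.isUnitStribola_h, Stribola.T_h⟩,
    fun _ _ hr hg hp => Stribola.eq_h_of_periodic hr hg hp⟩
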